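/- Consider $n$ items and unit-demand consumers. A consumer type is a valuation vector $v\in\mathbb{R}_{\ge 0}^n$; it is a uniform valuation if for some set $S$ of items and some $x\ge 0$ we have $v_i=x$ for $i\in S$ and $v_i=0$ for $i\notin S$. A consumer distribution $\mathcal{C}$ is a probability distribution on valuation vectors. An item pricing is a vector $p\in[0,+\infty]^n$. A consumer $v$ buys an item $i$ maximizing $v_i-p_i$ (the most expensive one in case of ties), or nothing and pays $0$ if $\max_i (v_i-p_i)<0$. Let $r^*(\mathcal{C})$ be the supremum, over all item pricings, of the expected payment of a consumer drawn from $\mathcal{C}$. A lottery is a pair $(\phi,p)$ of a vector $\phi\in\mathbb{R}_{\ge 0}^n$ with $\sum_i\phi_i\le 1$ and a price $p>0$; it allocates item $i$ with probability $\phi_i$, and no item with the remaining probability. A lottery system $\Lambda$ is a closed subset of $\mathbb{R}^n\times\mathbb{R}$ consisting of lotteries. In the buy-many model a consumer may buy any finite multiset (possibly empty) of lotteries from $\Lambda$ and receives an independent sample from each; her utility is the expectation of the maximum of her values for the items received ($0$ if she receives none) minus the sum of the prices paid. She buys a utility-maximizing bundle, the most expensive one in case of ties. Let $r^*_L(\mathcal{C})$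 be the supremum, over all lottery systems, of the expected payment of a consumer drawn from $\mathcal{C}$. **Theorem.** There is an absolute constant $c>0$ such that for every integer $n\ge 1$ there is a consumer distribution $\mathcal{C}$ on $n$ items, supported on uniform valuations, with $0<r^*(\mathcal{C})<\infty$, $r^*_L(\mathcal{C})<\infty$ and $$\frac{r^*_L(\mathcal{C})}{r^*(\mathcal{C})}\ \ge\ c\,\log n .$$ -/

import Mathlib

open MeasureTheory
open scoped NNReal ENNReal

noncomputable section

namespace BuyMany

/-- The valuation vector of a (unit-demand) consumer: a nonnegative value for each of `n` items. -/
abbrev Valuation (n : ℕ) : Type := Fin n → ℝ≥0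

/-- A lottery `(φ, p)`: item `i` is allocated with probability `φ i`, and the lottery costs `p`.
That the `φ i` sum to at most `1` is demanded in `LotterySystem`. -/
abbrev Lottery (n : ℕ) : Type := (Fin n → ℝ≥0) × ℝ≥0

/-- A system of lotteries that can be offered in the buy-many model: a closed set of lotteries
with positive prices (so that a utility-maximizing bundle exists for every consumer). -/
structure LotterySystem (n : ℕ) where
  carrier : Set (Lottery n)
  isClosed : IsClosed carrier
  sum_prob_le_one : ∀ l ∈ carrier, ∑ i, l.1 i ≤ 1
  price_pos : ∀ l ∈ carrier, 0 < l.2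

/-- The probability that a lottery has the given outcome; `none` stands for receiving no item. -/
def outcomeProb {n : ℕ} (l : Lottery n) : Option (Fin n) → ℝ
  | some i => (l.1 i : ℝ)
  | none => 1 - ∑ i, (l.1 i : ℝ)

/-- The value of an outcome of a lottery; receiving no item has value `0`. -/
def outcomeValue {n : ℕ} (v : Valuation n) : Option (Fin n) → ℝ≥0
  | some i => v i
  | none => 0

/-- The expected value, for a consumer with valuation `v`, of a bundle of `m` lotteries from each of
which she receives an independent sample: the expectation of the maximum of the values of the
outcomes (`0` for the empty bundle). -/
def expectedValue {n m : ℕ} (v : Valuation n) (b : Fin m → Lottery n) : ℝ :=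
  ∑ o : Fin m → Option (Fin n),
    (∏ j, outcomeProb (b j) (o j)) *
      ((Finset.univ.sup fun j => outcomeValue v (o j) : ℝ≥0) : ℝ)

/-- The total price of a bundle. -/
def totalPrice {n m : ℕ} (b : Fin m → Lottery n) : ℝ≥0 := ∑ j, (b j).2

/-- The utility of a bundle of lotteries. -/
def utility {n m : ℕ} (v : Valuation n) (b : Fin m → Lottery n) : ℝ :=
  expectedValue v b - (totalPrice b : ℝ)

/-- `b` is a utility-maximizing bundle of lotteries of the system `L`, repetitions being allowed.
The empty bundle, `m = 0`, is buying nothing. -/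
def IsOptimalBundle {n m : ℕ} (L : LotterySystem n) (v : Valuation n)
    (b : Fin m → Lottery n) : Prop :=
  (∀ j, b j ∈ L.carrier) ∧
    ∀ (m' : ℕ) (b' : Fin m' → Lottery n), (∀ j, b' j ∈ L.carrier) → utility v b' ≤ utility v b

/-- What a consumer with valuation `v` pays in the buy-many model: the price of the most expensive
one among her utility-maximizing bundles. -/
def lotteryPayment {n : ℕ} (L : LotterySystem n) (v : Valuation n) : ℝ≥0∞ :=
  ⨆ (m : ℕ) (b : Fin m → Lottery n) (_ : IsOptimalBundle L v b), (totalPrice b : ℝ≥0∞)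

/-- Under the item prices `p` (the price `⊤` meaning that an item is not for sale), item `i`
maximizes the utility `v i - p i` among all items, and this utility is not negative.
The inequalities between utilities are written without subtraction. -/
def IsOptimalItem {n : ℕ} (p : Fin n → ℝ≥0∞) (v : Valuation n) (i : Fin n) : Prop :=
  p i ≤ (v i : ℝ≥0∞) ∧ ∀ j, (v j : ℝ≥0∞) + p i ≤ (v i : ℝ≥0∞) + p j

/-- What a consumer with valuation `v` pays under the item prices `p`: the price of the most
expensive one among her utility-maximizing items, and `0` if all items have negative utility. -/
def itemPayment {n : ℕ} (p : Fin n → ℝ≥0∞) (v : Valuation n) : ℝ≥0∞ :=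
  ⨆ (i : Fin n) (_ : IsOptimalItem p v i), p i

/-- The optimal revenue from the consumer distribution `C` via a lottery system, in the buy-many
model. -/
def optLotteryRevenue {n : ℕ} (C : Measure (Valuation n)) : ℝ≥0∞ :=
  ⨆ L : LotterySystem n, ∫⁻ v, lotteryPayment L v ∂C

/-- The optimal revenue from the consumer distribution `C` via a pure item pricing. -/
def optItemRevenue {n : ℕ} (C : Measure (Valuation n)) : ℝ≥0∞ :=
  ⨆ p : Fin n → ℝ≥0∞, ∫⁻ v, itemPayment p v ∂C

/-- A uniform valuation: the same value `x` for all items of some set `S`, and value `0` for all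
other items. -/
def IsUniformValuation {n : ℕ} (v : Valuation n) : Prop :=
  ∃ (S : Set (Fin n)) (x : ℝ≥0), v = S.indicator fun _ => x

end BuyMany

end

namespace BuyMany

/-! ### Expected value of independent bundles -/

section Bundles

variable {n m : ℕ}

/-! Take `N = q ^ 3` item sets of size `q = 2 ^ (J + 1)`, pairwise meeting in at most two items: the
graphs of polynomials of degree at most 2 over the field with `q` elements. Consumer `a` wants the
set `T a`, has value `2 ^ ℓ a` with `ℓ a < J`, and has weight `2 ^ (-ℓ a)`, so she can contribute at
most 1.

Lotteries earn `N / 2`: offer a uniform item of each `T a` at half the value. Other consumers'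
lotteries hit `T a` too rarely to repay their price, even bought in bulk, so each consumer buys her
own (`half_le_lotteryPayment`).

Item prices earn only `O(N / J)` for well-chosen levels. A consumer pays the lowest price in her
set, and against a fixed price a uniformly random level yields `O(1 / J)` on average. An exponential
moment bound and a union bound over the `(J + 1) ^ n` price vectors rounded to powers of 2 give
levels that work for all prices at once, at an extra cost of `n * log (J + 1)` (`exists_levels`).
Since `n` is of order `q ^ 2`, having `q ^ 3` sets makes this cost negligible; `q ^ 2` lines would
not suffice. The ratio is of order `J`, hence of order `log n`. -/

theorem outcomeProb_nonneg {l : Lottery n} (h : ∑ i, l.1 i ≤ 1) (o : Option (Fin n)) :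
    0 ≤ outcomeProb l o := by
  cases o with
  | some i => exact (l.1 i).2
  | none =>
    have h' : ∑ i, (l.1 i : ℝ) ≤ 1 := by exact_mod_cast h
    simpa [outcomeProb] using h'

theorem sum_outcomeProb (l : Lottery n) : ∑ o, outcomeProb l o = 1 := by
  simp [Fintype.sum_option, outcomeProb]

theorem sum_outcomeProb_mul_outcomeValue (l : Lottery n) (v : Valuation n) :
    ∑ o, outcomeProb l o * (outcomeValue v o : ℝ) = ∑ i, (l.1 i : ℝ) * v i := by
  simp [Fintype.sum_option, outcomeProb, outcomeValue]

theorem sum_prod_outcomeProb (b : Fin m → Lottery n) :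
    ∑ o : Fin m → Option (Fin n), ∏ j, outcomeProb (b j) (o j) = 1 := by
  rw [← Fintype.piFinset_univ,
    ← Finset.prod_univ_sum (fun _ => Finset.univ) fun j o => outcomeProb (b j) o]
  exact Finset.prod_eq_one fun j _ => sum_outcomeProb _

/-- By independence the draws other than the `k`-th integrate to 1. -/
theorem sum_prod_outcomeProb_mul (b : Fin m → Lottery n) (k : Fin m) (f : Option (Fin n) → ℝ) :
    ∑ o : Fin m → Option (Fin n), (∏ j, outcomeProb (b j) (o j)) * f (o k) =
      ∑ o, outcomeProb (b k) o * f o := by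
  have h : ∀ o : Fin m → Option (Fin n), (∏ j, outcomeProb (b j) (o j)) * f (o k) =
      ∏ j, outcomeProb (b j) (o j) * (if j = k then f (o j) else 1) := by
    intro o
    rw [Finset.prod_mul_distrib]
    simp
  simp_rw [h]
  rw [← Fintype.piFinset_univ, ← Finset.prod_univ_sum (fun _ => Finset.univ)
    fun j o => outcomeProb (b j) o * (if j = k then f o else 1)]
  rw [Finset.prod_eq_single k]
  · simp
  · intro j _ hj
    simpa only [hj, if_false, mul_one] using sum_outcomeProb (b j)
  · simp

theorem expectedValue_le {v : Valuation n} {b : Fin m → Lottery n}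
    (hb : ∀ j, ∑ i, (b j).1 i ≤ 1) {x : ℝ≥0} (hv : ∀ i, v i ≤ x) : expectedValue v b ≤ x := by
  calc expectedValue v b
      ≤ ∑ o : Fin m → Option (Fin n), (∏ j, outcomeProb (b j) (o j)) * (x : ℝ) := by
        refine Finset.sum_le_sum fun o _ => mul_le_mul_of_nonneg_left ?_
          (Finset.prod_nonneg fun j _ => outcomeProb_nonneg (hb j) _)
        refine NNReal.coe_le_coe.2 (Finset.sup_le fun j _ => ?_)
        cases h : o j with
        | some i => exact hv i
        | none => exact zero_le
    _ = x := by rw [← Finset.sum_mul, sum_prod_outcomeProb, one_mul]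

/-- A maximum of nonnegative values is at most their sum. This makes bulk purchases additive, so
lotteries can be judged one at a time. -/
theorem expectedValue_le_sum (v : Valuation n) {b : Fin m → Lottery n}
    (hb : ∀ j, ∑ i, (b j).1 i ≤ 1) : expectedValue v b ≤ ∑ j, ∑ i, ((b j).1 i : ℝ) * v i := by
  calc expectedValue v b
      ≤ ∑ o : Fin m → Option (Fin n), (∏ j, outcomeProb (b j) (o j)) *
          ∑ k, (outcomeValue v (o k) : ℝ) := by
        refine Finset.sum_le_sum fun o _ => mul_le_mul_of_nonneg_left ?_
          (Finset.prod_nonneg fun j _ => outcomeProb_nonneg (hb j) _)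
        rw [← NNReal.coe_sum]
        refine NNReal.coe_le_coe.2 (Finset.sup_le fun j hj => ?_)
        exact Finset.single_le_sum (f := fun k => outcomeValue v (o k)) (fun _ _ => zero_le) hj
    _ = ∑ j, ∑ i, ((b j).1 i : ℝ) * v i := by
        simp_rw [Finset.mul_sum]
        rw [Finset.sum_comm]
        refine Finset.sum_congr rfl fun k _ => ?_
        rw [sum_prod_outcomeProb_mul b k fun o => (outcomeValue v o : ℝ),
          sum_outcomeProb_mul_outcomeValue]

theorem expectedValue_single (v : Valuation n) (l : Lottery n) :
    expectedValue v (fun _ : Fin 1 => l) = ∑ i, (l.1 i : ℝ) * v i := by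
  rw [← sum_outcomeProb_mul_outcomeValue, expectedValue]
  exact Fintype.sum_equiv (Equiv.funUnique (Fin 1) (Option (Fin n))) _ _ fun o => by simp

theorem utility_empty (v : Valuation n) (b : Fin 0 → Lottery n) : utility v b = 0 := by
  simp [utility, expectedValue, totalPrice]

theorem lotteryPayment_le (L : LotterySystem n) {v : Valuation n} {x : ℝ≥0}
    (hv : ∀ i, v i ≤ x) : lotteryPayment L v ≤ x := by
  refine iSup_le fun m => iSup_le fun b => iSup_le fun hb => ?_
  have h0 := hb.2 0 Fin.elim0 fun j => j.elim0
  rw [utility_empty, utility] at h0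
  have h1 := expectedValue_le (fun j => L.sum_prob_le_one _ (hb.1 j)) hv
  have : (totalPrice b : ℝ) ≤ x := by linarith
  exact_mod_cast this

/-- If there are finitely many lotteries, every consumer has a utility-maximizing bundle. -/
theorem exists_isOptimalBundle (L : LotterySystem n) (hL : L.carrier.Finite) (v : Valuation n) :
    ∃ (m : ℕ) (b : Fin m → Lottery n), IsOptimalBundle L v b := by
  classical
  rcases L.carrier.eq_empty_or_nonempty with hE | hne
  · refine ⟨0, Fin.elim0, fun j => j.elim0, fun m' b' hb' => ?_⟩
    rcases m' with _ | m'
    · simp [utility_empty]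
    · simpa [hE] using hb' 0
  obtain ⟨l₀, hl₀, hmin⟩ := hL.toFinset.exists_min_image (fun l => l.2) (by simpa using hne)
  rw [Set.Finite.mem_toFinset] at hl₀
  have hε : (0 : ℝ) < l₀.2 := L.price_pos _ hl₀
  set x : ℝ≥0 := Finset.univ.sup v
  have hv : ∀ i, v i ≤ x := fun i => Finset.le_sup (Finset.mem_univ i)
  -- More than `M` lotteries cost more than `x`, the largest possible value, so only the finitely
  -- many bundles of size at most `M` compete.
  obtain ⟨M, hM⟩ := exists_nat_gt ((x : ℝ) / l₀.2)
  rw [div_lt_iff₀ hε] at hM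
  have : Finite L.carrier := hL
  let B := Σ m : Fin (M + 1), (Fin m → L.carrier)
  have : Nonempty B := ⟨⟨0, fun j => j.elim0⟩⟩
  obtain ⟨⟨k, b⟩, hb⟩ := Finite.exists_max fun c : B => utility v fun j => (c.2 j : Lottery n)
  refine ⟨k, fun j => b j, fun j => (b j).2, fun m' b' hb' => ?_⟩
  by_cases hm : m' < M + 1
  · exact hb ⟨⟨m', hm⟩, fun j => ⟨b' j, hb' j⟩⟩
  · have h0 := hb ⟨0, fun j => j.elim0⟩
    replace h0 := (utility_empty v _).ge.trans h0
    refine le_trans ?_ h0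
    have h1 := expectedValue_le (fun j => L.sum_prob_le_one _ (hb' j)) hv
    have h2 : (m' : ℝ) * l₀.2 ≤ totalPrice b' := by
      have : m' • l₀.2 ≤ totalPrice b' := by
        simpa [totalPrice] using Finset.card_nsmul_le_sum Finset.univ (fun j => (b' j).2) l₀.2
          fun j _ => hmin _ (by simpa using hb' j)
      rw [nsmul_eq_mul] at this
      exact_mod_cast this
    have h3 : (M : ℝ) * l₀.2 ≤ m' * l₀.2 := by
      gcongr
      omega
    rw [utility]
    linarith

end Bundles

/-! ### Bounds and scaling of revenue -/

section Revenue

variable {n : ℕ}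

theorem itemPayment_le (p : Fin n → ℝ≥0∞) {v : Valuation n} {x : ℝ≥0} (hv : ∀ i, v i ≤ x) :
    itemPayment p v ≤ x :=
  iSup_le fun i => iSup_le fun hi => hi.1.trans (by exact_mod_cast hv i)

theorem optItemRevenue_smul (c : ℝ≥0∞) (μ : Measure (Valuation n)) :
    optItemRevenue (c • μ) = c * optItemRevenue μ := by
  simp [optItemRevenue, lintegral_smul_measure, ENNReal.mul_iSup]

theorem optLotteryRevenue_smul (c : ℝ≥0∞) (μ : Measure (Valuation n)) :
    optLotteryRevenue (c • μ) = c * optLotteryRevenue μ := by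
  simp [optLotteryRevenue, lintegral_smul_measure, ENNReal.mul_iSup]

end Revenue

/-! ### Uniform valuations and uniform lotteries -/

/-- The valuation that assigns the value `x` to the items of `T` and `0` to all others. -/
noncomputable def uniformValuation {n : ℕ} (T : Finset (Fin n)) (x : ℝ≥0) : Valuation n :=
  (T : Set (Fin n)).indicator fun _ => x

/-- The lottery that allocates a uniformly random item of `T`, at price `x`. -/
noncomputable def uniformLottery {n : ℕ} (T : Finset (Fin n)) (x : ℝ≥0) : Lottery n :=
  ((T : Set (Fin n)).indicator fun _ => (T.card : ℝ≥0)⁻¹, x)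

section Uniform

variable {n : ℕ}

theorem uniformValuation_apply (T : Finset (Fin n)) (x : ℝ≥0) (i : Fin n) :
    uniformValuation T x i = if i ∈ T then x else 0 := by
  simp [uniformValuation, Set.indicator_apply]

theorem uniformValuation_le (T : Finset (Fin n)) (x : ℝ≥0) (i : Fin n) :
    uniformValuation T x i ≤ x := by
  rw [uniformValuation_apply]
  split_ifs <;> simp

theorem uniformLottery_fst_apply (T : Finset (Fin n)) (x : ℝ≥0) (i : Fin n) :
    (uniformLottery T x).1 i = if i ∈ T then (T.card : ℝ≥0)⁻¹ else 0 := by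
  simp [uniformLottery, Set.indicator_apply]

theorem sum_uniformLottery_le_one (T : Finset (Fin n)) (x : ℝ≥0) :
    ∑ i, (uniformLottery T x).1 i ≤ 1 := by
  simp_rw [uniformLottery_fst_apply]
  simpa [div_eq_mul_inv] using div_self_le_one (T.card : ℝ≥0)

theorem sum_uniformLottery_mul_uniformValuation (S T : Finset (Fin n)) (x y : ℝ≥0) :
    ∑ i, ((uniformLottery S x).1 i : ℝ) * uniformValuation T y i =
      (S ∩ T).card / S.card * y := by
  have h : ∀ i, ((uniformLottery S x).1 i : ℝ) * uniformValuation T y i =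
      if i ∈ S ∩ T then (S.card : ℝ)⁻¹ * y else 0 := by
    intro i
    rw [uniformLottery_fst_apply, uniformValuation_apply]
    by_cases h1 : i ∈ S <;> by_cases h2 : i ∈ T <;> simp [h1, h2]
  simp_rw [h]
  rw [Finset.sum_ite_mem, Finset.univ_inter, Finset.sum_const, nsmul_eq_mul]
  ring

end Uniform

/-! ### Revenue from an almost disjoint family -/

section Family

variable {n : ℕ} {ι : Type*} [Fintype ι]

/-- The lottery system that offers the uniform lottery on each `T a` at price `2 ^ ℓ a / 2`. -/
noncomputable def halfPriceSystem (T : ι → Finset (Fin n)) (ℓ : ι → ℕ) : LotterySystem n where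
  carrier := Set.range fun a => uniformLottery (T a) (2 ^ ℓ a / 2)
  isClosed := (Set.finite_range _).isClosed
  sum_prob_le_one := by
    rintro _ ⟨a, rfl⟩
    exact sum_uniformLottery_le_one _ _
  price_pos := by
    rintro _ ⟨a, rfl⟩
    simp [uniformLottery]

/-- If the sets `T a` are almost disjoint, then a consumer of value `2 ^ ℓ a` for the items of `T a`
cannot avoid paying the price `2 ^ ℓ a / 2` of the lottery designed for her. -/
theorem half_le_lotteryPayment (T : ι → Finset (Fin n)) (ℓ : ι → ℕ) (hT : ∀ a, (T a).Nonempty)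
    (hinter : ∀ a b, a ≠ b → (T b ∩ T a).card * 2 ^ (ℓ a + 1) ≤ (T b).card) (a : ι) :
    ((2 ^ ℓ a / 2 : ℝ≥0) : ℝ≥0∞) ≤
      lotteryPayment (halfPriceSystem T ℓ) (uniformValuation (T a) (2 ^ ℓ a)) := by
  set L := halfPriceSystem T ℓ
  set v := uniformValuation (T a) (2 ^ ℓ a)
  -- Existence matters: with no optimal bundle, the supremum defining the payment would be 0.
  obtain ⟨m, b, hb⟩ := exists_isOptimalBundle L (Set.finite_range _) v
  refine le_iSup_of_le m (le_iSup_of_le b (le_iSup_of_le hb ?_))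
  have hpos : (0 : ℝ) < (T a).card := by exact_mod_cast (hT a).card_pos
  have hown := hb.2 1 (fun _ => uniformLottery (T a) (2 ^ ℓ a / 2)) fun _ => ⟨a, rfl⟩
  have hutil : utility v (fun _ : Fin 1 => uniformLottery (T a) (2 ^ ℓ a / 2)) = 2 ^ ℓ a / 2 := by
    rw [utility, expectedValue_single, sum_uniformLottery_mul_uniformValuation, Finset.inter_self,
      div_self hpos.ne']
    simp [totalPrice, uniformLottery]
    ring
  by_cases hex : ∃ j, b j = uniformLottery (T a) (2 ^ ℓ a / 2)
  · obtain ⟨j, hj⟩ := hex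
    have h := Finset.single_le_sum (f := fun j => (b j).2) (fun _ _ => zero_le) (Finset.mem_univ j)
    simp only [hj] at h
    exact_mod_cast h
  · exfalso
    push Not at hex
    -- A foreign lottery is worth at most `1 / 2` to her and costs `2 ^ ℓ a' / 2 ≥ 1 / 2`. A bundle
    -- of such lotteries has utility at most 0, while her own lottery alone has positive utility.
    have hle : expectedValue v b ≤ ∑ j, ((b j).2 : ℝ) := by
      refine (expectedValue_le_sum v fun j => L.sum_prob_le_one _ (hb.1 j)).trans ?_
      refine Finset.sum_le_sum fun j _ => ?_
      obtain ⟨a', ha'⟩ := hb.1 j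
      have hne : a ≠ a' := by
        rintro rfl
        exact hex j ha'.symm
      rw [← ha']
      simp only [v, sum_uniformLottery_mul_uniformValuation]
      have hpos' : (0 : ℝ) < (T a').card := by exact_mod_cast (hT a').card_pos
      have h1 : ((T a' ∩ T a).card : ℝ) * 2 ^ (ℓ a + 1) ≤ (T a').card := by
        exact_mod_cast hinter a a' hne
      have h2 : (1 : ℝ) ≤ 2 ^ ℓ a' := one_le_pow₀ one_le_two
      rw [div_mul_eq_mul_div, div_le_iff₀ hpos']
      simp only [uniformLottery]
      push_cast
      rw [pow_succ] at h1
      nlinarith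
    have h2 : (0 : ℝ) < 2 ^ ℓ a := by positivity
    rw [hutil, utility, totalPrice, NNReal.coe_sum] at hown
    linarith

/-- One consumer for each `a`, with value `2 ^ ℓ a` for the items of `T a`, and with weight
`2 ^ (-ℓ a)`. -/
noncomputable def equalRevenueMeasure (T : ι → Finset (Fin n)) (ℓ : ι → ℕ) : Measure (Valuation n) :=
  ∑ a, ((2 ^ ℓ a : ℝ≥0)⁻¹ : ℝ≥0∞) • Measure.dirac (uniformValuation (T a) (2 ^ ℓ a))

theorem lintegral_equalRevenueMeasure (T : ι → Finset (Fin n)) (ℓ : ι → ℕ)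
    (f : Valuation n → ℝ≥0∞) : ∫⁻ v, f v ∂equalRevenueMeasure T ℓ =
      ∑ a, ((2 ^ ℓ a : ℝ≥0)⁻¹ : ℝ≥0∞) * f (uniformValuation (T a) (2 ^ ℓ a)) := by
  simp [equalRevenueMeasure, lintegral_finsetSum_measure, lintegral_smul_measure, lintegral_dirac]

theorem equalRevenueMeasure_univ (T : ι → Finset (Fin n)) (ℓ : ι → ℕ) :
    equalRevenueMeasure T ℓ Set.univ = ∑ a, ((2 ^ ℓ a : ℝ≥0)⁻¹ : ℝ≥0∞) := by
  simpa using lintegral_equalRevenueMeasure T ℓ 1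

/-- Weight times value is 1 for each consumer. This gives finiteness of both revenues. -/
theorem lintegral_equalRevenueMeasure_le_card (T : ι → Finset (Fin n)) (ℓ : ι → ℕ)
    {f : Valuation n → ℝ≥0∞} (hf : ∀ v (x : ℝ≥0), (∀ i, v i ≤ x) → f v ≤ x) :
    ∫⁻ v, f v ∂equalRevenueMeasure T ℓ ≤ Fintype.card ι := by
  rw [lintegral_equalRevenueMeasure]
  calc _ ≤ ∑ a : ι, (1 : ℝ≥0∞) := by
        refine Finset.sum_le_sum fun a _ => ?_
        have h0 : ((2 ^ ℓ a : ℝ≥0) : ℝ≥0∞) ≠ 0 := by simp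
        calc _ ≤ ((2 ^ ℓ a : ℝ≥0)⁻¹ : ℝ≥0∞) * (2 ^ ℓ a : ℝ≥0) := by
              gcongr
              exact hf _ _ (uniformValuation_le _ _)
          _ = 1 := ENNReal.inv_mul_cancel h0 ENNReal.coe_ne_top
    _ = Fintype.card ι := by simp

theorem optItemRevenue_equalRevenueMeasure_le_card (T : ι → Finset (Fin n)) (ℓ : ι → ℕ) :
    optItemRevenue (equalRevenueMeasure T ℓ) ≤ Fintype.card ι :=
  iSup_le fun p => lintegral_equalRevenueMeasure_le_card T ℓ fun _ _ => itemPayment_le p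

theorem optLotteryRevenue_equalRevenueMeasure_le_card (T : ι → Finset (Fin n)) (ℓ : ι → ℕ) :
    optLotteryRevenue (equalRevenueMeasure T ℓ) ≤ Fintype.card ι :=
  iSup_le fun L => lintegral_equalRevenueMeasure_le_card T ℓ fun _ _ => lotteryPayment_le L

theorem half_card_le_optLotteryRevenue (T : ι → Finset (Fin n)) (ℓ : ι → ℕ)
    (hT : ∀ a, (T a).Nonempty)
    (hinter : ∀ a b, a ≠ b → (T b ∩ T a).card * 2 ^ (ℓ a + 1) ≤ (T b).card) :
    ENNReal.ofReal (Fintype.card ι / 2) ≤ optLotteryRevenue (equalRevenueMeasure T ℓ) := by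
  refine le_iSup_of_le (halfPriceSystem T ℓ) ?_
  rw [lintegral_equalRevenueMeasure]
  calc ENNReal.ofReal (Fintype.card ι / 2) = ∑ a : ι, ((2⁻¹ : ℝ≥0) : ℝ≥0∞) := by
        rw [Finset.sum_const, Finset.card_univ, nsmul_eq_mul, div_eq_mul_inv,
          ENNReal.ofReal_mul (by positivity), ENNReal.ofReal_natCast]
        congr 1
        rw [ENNReal.ofReal, Real.toNNReal_inv]
        simp
    _ ≤ _ := by
        refine Finset.sum_le_sum fun a _ => ?_
        calc ((2⁻¹ : ℝ≥0) : ℝ≥0∞)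
            = ((2 ^ ℓ a : ℝ≥0)⁻¹ : ℝ≥0∞) * ((2 ^ ℓ a / 2 : ℝ≥0) : ℝ≥0∞) := by
              rw [← ENNReal.coe_inv (by positivity), ← ENNReal.coe_mul]
              congr 1
              field_simp
          _ ≤ _ := by
              gcongr
              exact half_le_lotteryPayment T ℓ hT hinter a

theorem one_le_itemPayment_one {T : Finset (Fin n)} (hT : T.Nonempty) {x : ℝ≥0} (hx : 1 ≤ x) :
    1 ≤ itemPayment (fun _ => 1) (uniformValuation T x) := by
  obtain ⟨i, hi⟩ := hT
  have hv : uniformValuation T x i = x := by simp [uniformValuation_apply, hi]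
  refine le_iSup_of_le i (le_iSup_of_le ⟨?_, fun j => ?_⟩ le_rfl)
  · rw [hv]
    exact ENNReal.one_le_coe_iff.2 hx
  · rw [hv]
    gcongr
    exact uniformValuation_le _ _ _

theorem optItemRevenue_equalRevenueMeasure_pos [Nonempty ι] (T : ι → Finset (Fin n)) (ℓ : ι → ℕ)
    (hT : ∀ a, (T a).Nonempty) : 0 < optItemRevenue (equalRevenueMeasure T ℓ) := by
  refine lt_of_lt_of_le ?_ (le_iSup _ fun _ => 1)
  rw [lintegral_equalRevenueMeasure]
  obtain ⟨a⟩ := ‹Nonempty ι›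
  refine lt_of_lt_of_le ?_ (Finset.single_le_sum (fun _ _ => zero_le) (Finset.mem_univ a))
  refine ENNReal.mul_pos (by simp) (ne_of_gt ?_)
  exact lt_of_lt_of_le one_pos (one_le_itemPayment_one (hT a) (one_le_pow₀ one_le_two))

/-- Normalizing `equalRevenueMeasure` gives a distribution with the claimed ratio of revenues. -/
theorem exists_distribution_of_family [Nonempty ι] (T : ι → Finset (Fin n)) (ℓ : ι → ℕ)
    (hT : ∀ a, (T a).Nonempty)
    (hinter : ∀ a b, a ≠ b → (T b ∩ T a).card * 2 ^ (ℓ a + 1) ≤ (T b).card)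
    {B ρ : ℝ} (hB : 0 < B) (hitem : optItemRevenue (equalRevenueMeasure T ℓ) ≤ ENNReal.ofReal B)
    (hρ : ρ * B ≤ Fintype.card ι / 2) :
    ∃ C : Measure (Valuation n), IsProbabilityMeasure C ∧ (∀ᵐ v ∂C, IsUniformValuation v) ∧
      0 < optItemRevenue C ∧ optItemRevenue C < ⊤ ∧ optLotteryRevenue C < ⊤ ∧
      ENNReal.ofReal ρ ≤ optLotteryRevenue C / optItemRevenue C := by
  set μ := equalRevenueMeasure T ℓ with hμ
  have huniv : μ Set.univ = ∑ a, ((2 ^ ℓ a : ℝ≥0)⁻¹ : ℝ≥0∞) := equalRevenueMeasure_univ T ℓ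
  have htop : μ Set.univ ≠ ⊤ := by
    rw [huniv]
    exact ENNReal.sum_ne_top.2 fun a _ => by simp
  have hzero : μ Set.univ ≠ 0 := by
    rw [huniv]
    obtain ⟨a⟩ := ‹Nonempty ι›
    refine ne_of_gt (lt_of_lt_of_le ?_
      (Finset.single_le_sum (fun _ _ => zero_le) (Finset.mem_univ a)))
    exact pos_iff_ne_zero.2 (by simp)
  have hc0 : (μ Set.univ)⁻¹ ≠ 0 := ENNReal.inv_ne_zero.2 htop
  have hctop : (μ Set.univ)⁻¹ ≠ ⊤ := ENNReal.inv_ne_top.2 hzero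
  have hitem0 := optItemRevenue_equalRevenueMeasure_pos T ℓ hT
  have hcard : (Fintype.card ι : ℝ≥0∞) < ⊤ := ENNReal.natCast_lt_top _
  refine ⟨(μ Set.univ)⁻¹ • μ, ⟨?_⟩, ?_, ?_, ?_, ?_, ?_⟩
  · rw [Measure.smul_apply, smul_eq_mul, ENNReal.inv_mul_cancel hzero htop]
  · refine Measure.ae_smul_measure ?_ _
    rw [hμ, equalRevenueMeasure, ae_iff, Measure.finsetSum_apply]
    refine Finset.sum_eq_zero fun a _ => ?_
    have : IsUniformValuation (uniformValuation (T a) (2 ^ ℓ a)) := ⟨_, _, rfl⟩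
    simp [this]
  · rw [optItemRevenue_smul]
    exact ENNReal.mul_pos hc0 hitem0.ne'
  · rw [optItemRevenue_smul]
    exact ENNReal.mul_lt_top hctop.lt_top
      ((optItemRevenue_equalRevenueMeasure_le_card T ℓ).trans_lt hcard)
  · rw [optLotteryRevenue_smul]
    exact ENNReal.mul_lt_top hctop.lt_top
      ((optLotteryRevenue_equalRevenueMeasure_le_card T ℓ).trans_lt hcard)
  · rw [optItemRevenue_smul, optLotteryRevenue_smul, ENNReal.mul_div_mul_left _ _ hc0 hctop,
      ENNReal.le_div_iff_mul_le (Or.inl hitem0.ne')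
        (Or.inl ((optItemRevenue_equalRevenueMeasure_le_card T ℓ).trans_lt hcard).ne)]
    calc _ ≤ ENNReal.ofReal ρ * ENNReal.ofReal B := by gcongr
      _ = ENNReal.ofReal (ρ * B) := (ENNReal.ofReal_mul' hB.le).symm
      _ ≤ ENNReal.ofReal (Fintype.card ι / 2) := ENNReal.ofReal_le_ofReal hρ
      _ ≤ _ := half_card_le_optLotteryRevenue T ℓ hT hinter

end Family

/-! ### Choosing the levels by exponential moments -/

/-- The weighted payment `2 ^ k / 2 ^ l` of a consumer of value `2 ^ l` and weight `2 ^ (-l)` who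
faces the price `2 ^ k`. -/
noncomputable def scaledPayment (k l : ℕ) : ℝ := if k ≤ l then 2 ^ k / 2 ^ l else 0

theorem scaledPayment_nonneg (k l : ℕ) : 0 ≤ scaledPayment k l := by
  unfold scaledPayment
  split_ifs <;> positivity

theorem scaledPayment_le_one (k l : ℕ) : scaledPayment k l ≤ 1 := by
  unfold scaledPayment
  split_ifs with h
  · exact div_le_one_of_le₀ (pow_le_pow_right₀ one_le_two h) (by positivity)
  · exact zero_le_one

theorem sum_scaledPayment_le_two (k J : ℕ) : ∑ l : Fin J, scaledPayment k l ≤ 2 := by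
  rw [Fin.sum_univ_eq_sum_range (fun l => scaledPayment k l)]
  -- The exact geometric sum, which is what the induction can carry; it vanishes at `k = J`.
  suffices h : ∑ l ∈ Finset.range J, scaledPayment k l ≤
      if k ≤ J then 2 - 2 * 2 ^ k / 2 ^ J else 0 by
    refine h.trans ?_
    split_ifs
    · exact sub_le_self _ (by positivity)
    · exact zero_le_two
  induction J with
  | zero =>
    rcases Nat.eq_zero_or_pos k with rfl | hk
    · simp
    · simp [hk.ne']
  | succ J ih =>
    rw [Finset.sum_range_succ]
    refine (add_le_add_left ih _).trans ?_
    unfold scaledPayment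
    rcases lt_trichotomy k (J + 1) with h | h | h
    · rw [if_pos (by omega), if_pos (by omega), if_pos (by omega), pow_succ]
      apply le_of_eq
      field_simp
      ring
    · subst h
      simp
    · rw [if_neg (by omega), if_neg (by omega), if_neg (by omega)]
      simp

theorem sum_exp_scaledPayment_le (k J : ℕ) :
    ∑ l : Fin J, Real.exp (scaledPayment k l) ≤ J + 4 := by
  calc ∑ l : Fin J, Real.exp (scaledPayment k l)
      -- Uses `exp s ≤ 1 + 2 * s` on `[0, 1]`.
      ≤ ∑ l : Fin J, (1 + 2 * scaledPayment k l) := by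
        refine Finset.sum_le_sum fun l _ => ?_
        have h0 := scaledPayment_nonneg k l
        have h1 := scaledPayment_le_one k l
        have h2 := Real.abs_exp_sub_one_le (x := scaledPayment k l) (by rwa [abs_of_nonneg h0])
        rw [abs_of_nonneg h0] at h2
        linarith [le_abs_self (Real.exp (scaledPayment k l) - 1)]
    _ ≤ J + 4 := by
        rw [Finset.sum_add_distrib, ← Finset.mul_sum]
        have := sum_scaledPayment_le_two k J
        simp
        linarith

/-- Some assignment of levels is simultaneously balanced against every one of finitely many
price functions `κ r`. -/
theorem exists_levels {ι R : Type*} [Fintype ι] [Fintype R] (J : ℕ) (hJ : 0 < J) (κ : R → ι → ℕ) :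
    ∃ ℓ : ι → Fin J, ∀ r, ∑ a, scaledPayment (κ r a) (ℓ a) ≤
      Real.log (Fintype.card R) + 4 * Fintype.card ι / J := by
  classical
  have : Nonempty (Fin J) := ⟨⟨0, hJ⟩⟩
  have hJ' : (0 : ℝ) < J := by exact_mod_cast hJ
  -- `K` bounds the average over all `ℓ` of the sum over `r` of the exponentials. Some `ℓ` does no
  -- worse than average, and each single exponential is then at most `K`.
  set K : ℝ := Fintype.card R * Real.exp (4 * Fintype.card ι / J) with hK
  have htotal : ∑ ℓ : ι → Fin J, ∑ r, Real.exp (∑ a, scaledPayment (κ r a) (ℓ a)) ≤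
      ∑ _ℓ : ι → Fin J, K := by
    rw [Finset.sum_comm]
    calc ∑ r, ∑ ℓ : ι → Fin J, Real.exp (∑ a, scaledPayment (κ r a) (ℓ a))
        = ∑ r, ∏ a, ∑ l : Fin J, Real.exp (scaledPayment (κ r a) l) := by
          refine Finset.sum_congr rfl fun r _ => ?_
          simp_rw [Real.exp_sum]
          rw [← Fintype.piFinset_univ, ← Finset.prod_univ_sum (fun _ => Finset.univ)
            fun a (l : Fin J) => Real.exp (scaledPayment (κ r a) l)]
      _ ≤ ∑ r : R, ∏ a : ι, (J * Real.exp (4 / J)) := by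
          refine Finset.sum_le_sum fun r _ => Finset.prod_le_prod
            (fun a _ => Finset.sum_nonneg fun l _ => (Real.exp_pos _).le) fun a _ => ?_
          refine (sum_exp_scaledPayment_le _ _).trans ?_
          calc (J : ℝ) + 4 = J * (4 / J + 1) := by field_simp; ring
            _ ≤ _ := by gcongr; exact Real.add_one_le_exp _
      _ = ∑ _ℓ : ι → Fin J, K := by
          simp only [Finset.prod_const, Finset.sum_const, Finset.card_univ, nsmul_eq_mul,
            Fintype.card_fun, Fintype.card_fin, hK, mul_pow, ← Real.exp_nat_mul]
          push_cast
          ring_nf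
  obtain ⟨ℓ, -, hℓ⟩ := Finset.exists_le_of_sum_le Finset.univ_nonempty htotal
  refine ⟨ℓ, fun r => ?_⟩
  have hR : (0 : ℝ) < Fintype.card R := by exact_mod_cast Fintype.card_pos_iff.2 ⟨r⟩
  rw [← Real.exp_le_exp, Real.exp_add, Real.exp_log hR]
  exact (Finset.single_le_sum (f := fun r => Real.exp (∑ a, scaledPayment (κ r a) (ℓ a)))
    (fun _ _ => (Real.exp_pos _).le) (Finset.mem_univ r)).trans hℓ

/-! ### Item pricings reduced to rounded prices -/

section ItemPricing

variable {n : ℕ}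

/-- The least `k < J` such that the price of item `i` is at most `2 ^ k`, and `J` if there is
none. -/
theorem exists_roundedPrice (J : ℕ) (p : Fin n → ℝ≥0∞) :
    ∃ r : Fin n → Fin (J + 1), ∀ i, ((r i : ℕ) < J → p i ≤ 2 ^ (r i : ℕ)) ∧
      ∀ k : ℕ, p i ≤ 2 ^ k → (r i : ℕ) ≤ k := by
  classical
  have hex : ∀ i, ∃ k : ℕ, J ≤ k ∨ p i ≤ 2 ^ k := fun i => ⟨J, Or.inl le_rfl⟩
  refine ⟨fun i => ⟨Nat.find (hex i), Nat.lt_succ_of_le (Nat.find_min' _ (Or.inl le_rfl))⟩,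
    fun i => ⟨fun h => ?_, fun k hk => Nat.find_min' _ (Or.inr hk)⟩⟩
  exact (Nat.find_spec (hex i)).resolve_left (not_le.2 h)

/-- Her values agree on `T`, so a purchase in `T` is at its lowest price, which rounding only
raises. Rounding keeps unaffordable prices unaffordable, as values are powers of 2. An item outside
`T` is bought only at price 0. -/
theorem scaled_itemPayment_le {J : ℕ} {p : Fin n → ℝ≥0∞} {r : Fin n → Fin (J + 1)}
    (hr : ∀ i, ((r i : ℕ) < J → p i ≤ 2 ^ (r i : ℕ)) ∧ ∀ k : ℕ, p i ≤ 2 ^ k → (r i : ℕ) ≤ k)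
    (T : Finset (Fin n)) (hT : T.Nonempty) (l : Fin J) :
    ((2 ^ (l : ℕ) : ℝ≥0)⁻¹ : ℝ≥0∞) * itemPayment p (uniformValuation T (2 ^ (l : ℕ))) ≤
      ENNReal.ofReal (scaledPayment (T.inf r : Fin (J + 1)) l) := by
  rw [itemPayment]
  simp only [ENNReal.mul_iSup]
  refine iSup_le fun i => iSup_le fun hi => ?_
  obtain ⟨h1, h2⟩ := hi
  by_cases hiT : i ∈ T
  · rw [uniformValuation_apply, if_pos hiT] at h1
    have hil : (r i : ℕ) ≤ l := (hr i).2 _ (by exact_mod_cast h1)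
    have hinf : ((T.inf r : Fin (J + 1)) : ℕ) ≤ l := le_trans (Fin.le_def.1 (Finset.inf_le hiT)) hil
    obtain ⟨i', hi'T, hi'⟩ := Finset.exists_mem_eq_inf T hT r
    have hle : p i ≤ p i' := by
      have := h2 i'
      rw [uniformValuation_apply, uniformValuation_apply, if_pos hiT, if_pos hi'T] at this
      exact (ENNReal.add_le_add_iff_left ENNReal.coe_ne_top).1 this
    have hp : p i' ≤ 2 ^ (r i' : ℕ) := (hr i').1 (by rw [← hi']; exact hinf.trans_lt l.2)
    rw [scaledPayment, if_pos hinf, hi', div_eq_inv_mul, ENNReal.ofReal_mul (by positivity),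
      ENNReal.ofReal_inv_of_pos (by positivity), ENNReal.ofReal_pow (by positivity),
      ENNReal.ofReal_pow (by positivity)]
    simp only [ENNReal.ofReal_ofNat, ENNReal.coe_pow, ENNReal.coe_ofNat]
    gcongr
    exact hle.trans hp
  · rw [uniformValuation_apply, if_neg hiT] at h1
    simp at h1
    simp [h1]

/-- For sufficiently many sets, levels can be chosen such that no item pricing earns much. -/
theorem exists_levels_optItemRevenue_le {ι : Type*} [Fintype ι] (T : ι → Finset (Fin n))
    (hT : ∀ a, (T a).Nonempty) (J : ℕ) (hJ : 0 < J) :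
    ∃ ℓ : ι → Fin J, optItemRevenue (equalRevenueMeasure T fun a => ℓ a) ≤
      ENNReal.ofReal (n * Real.log (J + 1) + 4 * Fintype.card ι / J) := by
  obtain ⟨ℓ, hℓ⟩ := exists_levels (R := Fin n → Fin (J + 1)) J hJ
    fun r a => ((T a).inf r : Fin (J + 1))
  refine ⟨ℓ, iSup_le fun p => ?_⟩
  obtain ⟨r, hr⟩ := exists_roundedPrice J p
  rw [lintegral_equalRevenueMeasure]
  calc _ ≤ ∑ a, ENNReal.ofReal (scaledPayment ((T a).inf r : Fin (J + 1)) (ℓ a)) :=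
        Finset.sum_le_sum fun a _ => scaled_itemPayment_le hr (T a) (hT a) (ℓ a)
    _ = ENNReal.ofReal (∑ a, scaledPayment ((T a).inf r : Fin (J + 1)) (ℓ a)) :=
        (ENNReal.ofReal_sum_of_nonneg fun _ _ => scaledPayment_nonneg _ _).symm
    _ ≤ _ := by
        refine ENNReal.ofReal_le_ofReal ((hℓ r).trans_eq ?_)
        simp

end ItemPricing

/-! ### Almost disjoint sets from quadratic polynomials -/

section Graphs

open Polynomial

variable {F : Type*} [Field F] [Fintype F] [DecidableEq F]

/-- The graph of the polynomial `a.1 * x ^ 2 + a.2.1 * x + a.2.2`. -/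
def quadraticGraph (a : F × F × F) : Finset (F × F) :=
  Finset.univ.image fun x => (x, a.1 * x ^ 2 + a.2.1 * x + a.2.2)

theorem mem_quadraticGraph {a : F × F × F} {z : F × F} :
    z ∈ quadraticGraph a ↔ z.2 = a.1 * z.1 ^ 2 + a.2.1 * z.1 + a.2.2 := by
  simp only [quadraticGraph, Finset.mem_image, Finset.mem_univ, true_and]
  constructor
  · rintro ⟨x, rfl⟩
    rfl
  · intro h
    exact ⟨z.1, Prod.ext rfl h.symm⟩

theorem card_quadraticGraph (a : F × F × F) : (quadraticGraph a).card = Fintype.card F := by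
  rw [quadraticGraph, Finset.card_image_of_injective, Finset.card_univ]
  exact fun _ _ h => (Prod.ext_iff.1 h).1

/-- Common points have distinct first coordinates, all roots of the nonzero difference polynomial.
Comparing coefficients, not values, keeps this valid over small fields. -/
theorem card_quadraticGraph_inter_le {a b : F × F × F} (h : a ≠ b) :
    (quadraticGraph a ∩ quadraticGraph b).card ≤ 2 := by
  set P : F[X] := C (a.1 - b.1) * X ^ 2 + C (a.2.1 - b.2.1) * X + C (a.2.2 - b.2.2) with hP
  have hP0 : P ≠ 0 := by
    intro h0
    have h2 : P.coeff 2 = a.1 - b.1 := by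
      simp [hP, -map_sub]
    have h1 : P.coeff 1 = a.2.1 - b.2.1 := by
      simp [hP, -map_sub, coeff_C]
    have h3 : P.coeff 0 = a.2.2 - b.2.2 := by
      simp [hP, -map_sub, coeff_X]
    rw [h0, coeff_zero, eq_comm, sub_eq_zero] at h1 h2 h3
    exact h (Prod.ext h2 (Prod.ext h1 h3))
  calc (quadraticGraph a ∩ quadraticGraph b).card ≤ P.roots.toFinset.card := by
        refine Finset.card_le_card_of_injOn Prod.fst (fun z hz => ?_) fun z hz w hw hzw => ?_
        · rw [Finset.mem_coe, Finset.mem_inter, mem_quadraticGraph, mem_quadraticGraph] at hz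
          rw [Finset.mem_coe, Multiset.mem_toFinset, mem_roots hP0, IsRoot.def]
          simp only [hP, eval_add, eval_mul, eval_C, eval_pow, eval_X]
          linear_combination hz.2 - hz.1
        · rw [Finset.mem_coe, Finset.mem_inter, mem_quadraticGraph] at hz hw
          exact Prod.ext hzw (by rw [hz.1, hw.1, hzw])
    _ ≤ P.natDegree := (Multiset.toFinset_card_le _).trans (card_roots' P)
    _ ≤ 2 := natDegree_quadratic_le

end Graphs

/-- For `n ≥ 4 ^ (J + 1)` items there are `8 ^ (J + 1)` sets of `2 ^ (J + 1)` items that pairwise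
intersect in at most two items. -/
theorem exists_almostDisjoint_family (n J : ℕ) (hn : 4 ^ (J + 1) ≤ n) :
    ∃ T : Fin (8 ^ (J + 1)) → Finset (Fin n), (∀ a, (T a).card = 2 ^ (J + 1)) ∧
      ∀ a b, a ≠ b → (T a ∩ T b).card ≤ 2 := by
  classical
  let F := GaloisField 2 (J + 1)
  have hcard : Nat.card F = 2 ^ (J + 1) := GaloisField.card 2 (J + 1) (by omega)
  have : Finite F := Nat.finite_of_card_ne_zero (by rw [hcard]; positivity)
  have : Fintype F := Fintype.ofFinite F
  rw [Nat.card_eq_fintype_card] at hcard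
  obtain ⟨e⟩ : Nonempty (F × F ↪ Fin n) := by
    refine Function.Embedding.nonempty_of_card_le ?_
    rw [Fintype.card_prod, Fintype.card_fin, hcard, ← mul_pow]
    exact hn
  have e' : Fin (8 ^ (J + 1)) ≃ F × F × F := by
    refine Fintype.equivOfCardEq ?_
    rw [Fintype.card_prod, Fintype.card_prod, Fintype.card_fin, hcard, ← mul_pow, ← mul_pow]
    norm_num
  refine ⟨fun a => (quadraticGraph (e' a)).map e, fun a => ?_, fun a b hab => ?_⟩
  · rw [Finset.card_map, card_quadraticGraph, hcard]
  · rw [← Finset.map_inter, Finset.card_map]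
    exact card_quadraticGraph_inter_le (e'.injective.ne hab)

/-! ### Numerical estimates and conclusion -/

theorem sq_le_two_mul_two_pow (J : ℕ) : J ^ 2 ≤ 2 * 2 ^ J := by
  induction J with
  | zero => simp
  | succ J ih =>
    rcases Nat.lt_or_ge J 3 with h | h
    · interval_cases J <;> norm_num
    · rw [pow_succ 2 J]
      nlinarith

theorem log_four_le_two : Real.log 4 ≤ 2 := by
  have h : Real.log 4 = 2 * Real.log 2 := by
    rw [show (4 : ℝ) = 2 ^ 2 by norm_num, Real.log_pow]
    norm_num
  linarith [Real.log_two_lt_d9]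

end BuyMany

theorem theorem4p3 :
    ∃ c : ℝ, 0 < c ∧ ∀ n : ℕ, 1 ≤ n →
      ∃ C : MeasureTheory.Measure (BuyMany.Valuation n),
        MeasureTheory.IsProbabilityMeasure C ∧
        (∀ᵐ v ∂C, BuyMany.IsUniformValuation v) ∧
        0 < BuyMany.optItemRevenue C ∧ BuyMany.optItemRevenue C < ⊤ ∧
        BuyMany.optLotteryRevenue C < ⊤ ∧
        ENNReal.ofReal (c * Real.log n) ≤
          BuyMany.optLotteryRevenue C / BuyMany.optItemRevenue C := by
  refine ⟨1 / 100, by norm_num, fun n hn => ?_⟩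
  set k := Nat.log 4 n
  have hk : 4 ^ k ≤ n := Nat.pow_log_le_self 4 (by omega)
  have hk' : n < 4 ^ (k + 1) := Nat.lt_pow_succ_log_self (by norm_num) n
  have hlog : Real.log n ≤ 2 * (k + 1) := by
    have h1 : Real.log n ≤ Real.log (4 ^ (k + 1)) :=
      Real.log_le_log (by exact_mod_cast hn) (by exact_mod_cast hk'.le)
    rw [Real.log_pow] at h1
    push_cast at h1
    have h0 : (0 : ℝ) ≤ k + 1 := by positivity
    nlinarith [BuyMany.log_four_le_two]
  rcases Nat.lt_or_ge k 2 with hk2 | hk2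
  -- Here `log n ≤ 4`, so one consumer, with ratio at least `1 / 2`, suffices.
  · have hk1 : (k : ℝ) ≤ 1 := by exact_mod_cast Nat.le_of_lt_succ hk2
    refine BuyMany.exists_distribution_of_family (ι := Unit) (fun _ => {⟨0, hn⟩}) (fun _ => 0)
      (fun _ => Finset.singleton_nonempty _) (fun a b hab => absurd rfl hab) one_pos
      ((BuyMany.optItemRevenue_equalRevenueMeasure_le_card _ _).trans ?_) ?_
    · simp
    · simp
      linarith
  · obtain ⟨J, hJ⟩ : ∃ J, k = J + 1 := ⟨k - 1, by omega⟩
    have hJ0 : 0 < J := by omega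
    rw [hJ] at hk hk' hlog
    obtain ⟨T, hTcard, hTinter⟩ := BuyMany.exists_almostDisjoint_family n J hk
    have hT : ∀ a, (T a).Nonempty := fun a => Finset.card_pos.1 (by rw [hTcard]; positivity)
    obtain ⟨ℓ, hℓ⟩ := BuyMany.exists_levels_optItemRevenue_le T hT J hJ0
    have hJ1 : (1 : ℝ) ≤ J := by exact_mod_cast hJ0
    have : Nonempty (Fin (8 ^ (J + 1))) := ⟨⟨0, by positivity⟩⟩
    refine BuyMany.exists_distribution_of_family T (fun a => ℓ a) hT (fun a b hab => ?_)
      -- Half of `B` pays for the union bound, half for the mean.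
      (B := 8 * 8 ^ (J + 1) / J) (by positivity) (hℓ.trans (ENNReal.ofReal_le_ofReal ?_)) ?_
    · rw [hTcard, pow_succ' 2 J]
      exact Nat.mul_le_mul (hTinter b a hab.symm) (Nat.pow_le_pow_right (by norm_num) (ℓ a).2)
    · have h1 : Real.log (J + 1) ≤ J := by
        simpa using Real.log_le_sub_one_of_pos (x := (J : ℝ) + 1) (by positivity)
      have h0 : 0 ≤ Real.log (J + 1) := Real.log_nonneg (by linarith)
      have h2 : (n : ℝ) ≤ 16 * 4 ^ J := by
        have : (n : ℝ) ≤ 4 ^ (J + 1 + 1) := by exact_mod_cast hk'.le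
        rw [pow_succ, pow_succ] at this
        linarith
      have h3 : (J : ℝ) ^ 2 ≤ 2 * 2 ^ J := by exact_mod_cast BuyMany.sq_le_two_mul_two_pow J
      have h4 : n * Real.log (J + 1) ≤ 4 * 8 ^ (J + 1) / J := by
        rw [le_div_iff₀ (by positivity)]
        calc n * Real.log (J + 1) * J ≤ 16 * 4 ^ J * J * J := by gcongr
          _ = 16 * 4 ^ J * J ^ 2 := by ring
          _ ≤ 16 * 4 ^ J * (2 * 2 ^ J) := by gcongr
          _ = 32 * (4 * 2) ^ J := by rw [mul_pow]; ring
          _ = 4 * 8 ^ (J + 1) := by rw [pow_succ]; norm_num; ring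
      simp only [Fintype.card_fin]
      push_cast
      calc _ ≤ 4 * 8 ^ (J + 1) / J + 4 * 8 ^ (J + 1) / (J : ℝ) := by gcongr
        _ = _ := by ring
    · simp only [Fintype.card_fin]
      push_cast
      have h8 : (0 : ℝ) < 8 ^ (J + 1) := by positivity
      push_cast at hlog
      -- What remains follows from `16 * (J + 2) / 100 ≤ J / 2`, true for `J ≥ 1`.
      rw [mul_div_assoc', div_le_iff₀ (by positivity)]
      nlinarith
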